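/- Let $\ell^\infty=\ell^\infty(\mathbb Z)$ be the space of bounded real sequences with the norm $\|f\|=\sup_n|f_n|$. A map $T:\ell^\infty\to\ell^\infty$ is called *uniformly convergent* if for every $f\in\ell^\infty$ there is a bounded continuous function $T^\infty f:\mathbb R\to\mathbb R$ (necessarily unique if $T$ is interpolatory, i.e. $T(f)_{2n}=f_n$ for all $f,n$) such that $$\lim_{j\to\infty}\ \sup_{n\in\mathbb Z}\bigl|T^j(f)_n-(T^\infty f)(2^{-j}n)\bigr|=0 .$$ For $0<r\le 1$ let $C^{r-}$ be the set of bounded continuous functions $g:\mathbb R\to\mathbb R$ such that for every $0<s<r$ there is $C>0$ with $|g(x)-g(y)|\le C|x-y|^{s}$ for all $x,y\in\mathbb R$; for $\alpha=p+r>0$ with $p\in\mathbb N$ and $0<r\le1$ let $C^{\alpha-}$ be the set of $g\in C^p(\mathbb R)$ with $g^{(p)}\in C^{r-}$. **Theorem.** Let $S:\ell^\infty\to\ell^\infty$ be bounded, linear, interpolatory and uniformly convergent, let $\delta:\ell^\infty\to\ell^\infty$ be bounded and linear, and let $F:\ell^\infty\to\ell^\infty$ be an arbitrary (possibly nonlinear)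 map such that $F(\delta f)_{2n}=0$ for all $f\in\ell^\infty$ and $n\in\mathbb Z$. Define $$S_{NL}(f)_{2n+1}=S(f)_{2n+1}+F(\delta f)_{2n+1},\qquad S_{NL}(f)_{2n}=f_n .$$ Assume that there are $M>0$ and $c<1$ such that $\|F(d)\|\le M\|d\|$ for all $d\in\ell^\infty$ and $$\|\delta S(f)+\delta F(\delta f)\|\le c\,\|\delta f\|\qquad\text{for all } f\in\ell^\infty .$$ Then $S_{NL}$ is uniformly convergent. Moreover, if $\alpha>0$ and $S^\infty f\in C^{\alpha-}$ for every $f\in\ell^\infty$, then $S_{NL}^\infty f\in C^{\beta-}$ for every $f\in\ell^\infty$, where $\beta=\min(\alpha,-\log_2 c)$ (with $-\log_2 c=+\infty$ if $c\le 0$). -/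

import Mathlib

open scoped ENNReal

/-- The Banach space of bounded real sequences indexed by the integers, with the sup norm. -/
abbrev BddSeq : Type := lp (fun _ : ℤ => ℝ) ∞

/-- A scheme is interpolatory if it keeps the old values at the even indices. -/
def Interpolatory (T : BddSeq → BddSeq) : Prop :=
  ∀ (f : BddSeq) (n : ℤ), T f (2 * n) = f n

/-- `g` is the limit function `T^∞ f`: it is a bounded continuous function on the line, and
`sup_n |(T^j f)_n - g (2^(-j) n)|` tends to `0` as `j` tends to infinity. -/
def IsLimitFunction (T : BddSeq → BddSeq) (f : BddSeq) (g : ℝ → ℝ) : Prop :=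
  Continuous g ∧ (∃ C : ℝ, ∀ x, |g x| ≤ C) ∧
    ∀ ε : ℝ, 0 < ε → ∃ J : ℕ, ∀ j : ℕ, J ≤ j → ∀ n : ℤ,
      |(T^[j] f) n - g ((n : ℝ) / 2 ^ j)| ≤ ε

/-- A scheme is uniformly convergent if every bounded sequence has a limit function. -/
def UniformlyConvergent (T : BddSeq → BddSeq) : Prop :=
  ∀ f : BddSeq, ∃ g : ℝ → ℝ, IsLimitFunction T f g

/-- The values of the perturbed scheme: `f_n` at the index `2n`, and
`S(f)_{2n+1} + F(δ f)_{2n+1}` at the index `2n+1`. -/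
noncomputable def nonlinearSchemeFun (S δ : BddSeq →L[ℝ] BddSeq) (F : BddSeq → BddSeq) (f : BddSeq) (k : ℤ) :
    ℝ :=
  if Even k then f (k / 2) else S f k + F (δ f) k

theorem nonlinearSchemeFun_memlp (S δ : BddSeq →L[ℝ] BddSeq) (F : BddSeq → BddSeq)
    (f : BddSeq) : Memℓp (E := fun _ : ℤ => ℝ) (nonlinearSchemeFun S δ F f) ∞ := by
  refine memℓp_infty ⟨‖f‖ + (‖S f‖ + ‖F (δ f)‖), ?_⟩
  rintro _ ⟨k, rfl⟩
  have h1 : ‖f (k / 2)‖ ≤ ‖f‖ := lp.norm_apply_le_norm ENNReal.top_ne_zero f _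
  have h2 : ‖S f k‖ ≤ ‖S f‖ := lp.norm_apply_le_norm ENNReal.top_ne_zero _ _
  have h3 : ‖F (δ f) k‖ ≤ ‖F (δ f)‖ := lp.norm_apply_le_norm ENNReal.top_ne_zero _ _
  have h4 := norm_nonneg f
  have h5 := norm_nonneg (S f)
  have h6 := norm_nonneg (F (δ f))
  have h7 := norm_add_le (S f k) (F (δ f) k)
  simp only [nonlinearSchemeFun]
  split_ifs <;> linarith

/-- The nonlinear scheme `S_NL`, as an operator on bounded sequences. -/
noncomputable def nonlinearScheme (S δ : BddSeq →L[ℝ] BddSeq) (F : BddSeq → BddSeq) (f : BddSeq) : BddSeq :=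
  ⟨nonlinearSchemeFun S δ F f, nonlinearSchemeFun_memlp S δ F f⟩

theorem nonlinearScheme_even (S δ : BddSeq →L[ℝ] BddSeq) (F : BddSeq → BddSeq) (f : BddSeq)
    (n : ℤ) : nonlinearScheme S δ F f (2 * n) = f n := by
  change nonlinearSchemeFun S δ F f (2 * n) = f n
  simp [nonlinearSchemeFun]

theorem nonlinearScheme_odd (S δ : BddSeq →L[ℝ] BddSeq) (F : BddSeq → BddSeq) (f : BddSeq)
    (n : ℤ) : nonlinearScheme S δ F f (2 * n + 1) =
      S f (2 * n + 1) + F (δ f) (2 * n + 1) := by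
  change nonlinearSchemeFun S δ F f (2 * n + 1) = _
  simp [nonlinearSchemeFun]

/-- The class `C^{r-}` for `0 < r ≤ 1`: bounded continuous functions that are globally
Hölder continuous of every exponent `s` with `0 < s < r`. -/
def HolderMinus (r : ℝ) (g : ℝ → ℝ) : Prop :=
  Continuous g ∧ (∃ C : ℝ, ∀ x, |g x| ≤ C) ∧
    ∀ s : ℝ, 0 < s → s < r → ∃ C : ℝ, 0 < C ∧ ∀ x y : ℝ, |g x - g y| ≤ C * |x - y| ^ s

/-- The class `C^{α-}` for `α > 0`: write `α = p + r` with `p` a natural number and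
`0 < r ≤ 1` (in a unique way); the `p`-th derivative exists and is in `C^{r-}`. -/
def CMinus (α : ℝ) (g : ℝ → ℝ) : Prop :=
  ∃ (p : ℕ) (r : ℝ), α = p + r ∧ 0 < r ∧ r ≤ 1 ∧
    ContDiff ℝ p g ∧ HolderMinus r (iteratedDeriv p g)

/-- The exponent `min(α, -log₂ c)`, where `-log₂ c` is read as `+∞` for `c ≤ 0`. -/
noncomputable def limitExponent (α c : ℝ) : ℝ :=
  if 0 < c then min α (-Real.logb 2 c) else α

/-! Interpolation gives `S_NL = S + F ∘ δ`. Iterating and using linearity of `S`, one gets `S_NL^J f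
= ∑_{j ≤ J} S^{J-j} e_j` with `e_0 = f` and `e_{j+1} = F(δ S_NL^j f)` (`iterate_nonlinearScheme`).
The contraction hypothesis gives `‖e_j‖ ≤ A c^j`, so the limit must be `∑ (S^∞ e_j)(2^j x)`
(`isLimitFunction_tsum`).

For regularity, `p` derivatives and a Hölder quotient of exponent `s` cost a factor `2^{j(p+s)}` in
the `j`-th term, and the series still converges when `2^{p+s} c < 1` (`cMinus_tsum`). The needed
constants are linear in `‖e_j‖` by Banach–Steinhaus, applied to the functionals `e ↦ (S^∞
e)^{(k)}(x)` and their Hölder quotients. -/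

/-! ### Interpolation between derivatives -/

/-- If a function and its `p`-th derivative are bounded, so are the derivatives in between, with
a bound that depends only on the two given ones. -/
theorem exists_bound_iteratedDeriv (p : ℕ) : ∀ A B : ℝ, ∃ C : ℝ, ∀ g : ℝ → ℝ, ContDiff ℝ p g →
    (∀ x, |g x| ≤ A) → (∀ x, |iteratedDeriv p g x| ≤ B) →
    ∀ k ≤ p, ∀ x, |iteratedDeriv k g x| ≤ C := by
  induction p with
  | zero =>
    intro A B
    refine ⟨A, fun g _ hA _ k hk x => ?_⟩
    obtain rfl : k = 0 := by omega
    simpa using hA x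
  | succ p ih =>
    intro A B
    rcases Nat.eq_zero_or_pos p with rfl | hp
    · refine ⟨max A B, fun g _ hA hB k hk x => ?_⟩
      interval_cases k
      · simpa using Or.inl (hA x)
      · exact le_max_of_le_right (hB x)
    -- `C₁` serves the differences `g(· + h) - g` with `0 ≤ h ≤ 1`, whose `p`-th derivatives are at
    -- most `B` by the mean value inequality. `C₂` serves `g'`.
    obtain ⟨C₁, hC₁⟩ := ih (2 * A) B
    obtain ⟨C₂, hC₂⟩ := ih (2 * A + C₁) B
    refine ⟨max A C₂, fun g hg hA hB k hk x => ?_⟩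
    have hgp : ContDiff ℝ p g := hg.of_le (by exact_mod_cast Nat.le_succ p)
    have hgd : Differentiable ℝ g := hg.differentiable (by simp)
    have hdiff : Differentiable ℝ (iteratedDeriv p g) := by
      refine hg.differentiable_iteratedDeriv p ?_
      exact_mod_cast Nat.lt_succ_self p
    have hstep : ∀ h : ℝ, 0 ≤ h → h ≤ 1 → ∀ x, |deriv g (x + h) - deriv g x| ≤ C₁ := by
      intro h h0 h1 x
      have hsh : ContDiff ℝ p fun y => g (y + h) := hgp.comp (contDiff_id.add contDiff_const)
      have key : ∀ k ≤ p, ∀ y, iteratedDeriv k (fun y => g (y + h) - g y) y =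
          iteratedDeriv k g (y + h) - iteratedDeriv k g y := by
        intro k hk y
        have hk' : (k : WithTop ℕ∞) ≤ p := by exact_mod_cast hk
        rw [iteratedDeriv_fun_sub (hsh.of_le hk').contDiffAt (hgp.of_le hk').contDiffAt,
          iteratedDeriv_comp_add_const]
      have := hC₁ (fun y => g (y + h) - g y) (hsh.sub hgp)
        (fun y => by
          have := abs_sub (g (y + h)) (g y)
          linarith [hA (y + h), hA y])
        (fun y => by
          rw [key p le_rfl]
          have := Convex.norm_image_sub_le_of_norm_deriv_le (s := Set.univ)
            (f := iteratedDeriv p g) (C := B) (fun z _ => hdiff z)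
            (fun z _ => by rw [← iteratedDeriv_succ]; exact hB z) convex_univ
            (Set.mem_univ y) (Set.mem_univ (y + h))
          have hB0 : 0 ≤ B := (abs_nonneg _).trans (hB 0)
          simp only [Real.norm_eq_abs, add_sub_cancel_left, abs_of_nonneg h0] at this
          nlinarith) 1 hp x
      rw [key 1 hp] at this
      simpa using this
    -- In `[x, x + 1]` some value of `g'` equals `g(x+1) - g(x)`, at most `2A` in size; `hstep`
    -- carries this bound over to `x`.
    have hderiv : ∀ x, |deriv g x| ≤ 2 * A + C₁ := by
      intro x
      obtain ⟨ξ, ⟨h1, h2⟩, h3⟩ := exists_deriv_eq_slope g (a := x) (b := x + 1) (by linarith)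
        hgd.continuous.continuousOn hgd.differentiableOn
      have h4 := hstep (ξ - x) (by linarith) (by linarith) x
      rw [add_sub_cancel, h3, add_sub_cancel_left, div_one] at h4
      have h5 := hA x
      have h6 := hA (x + 1)
      rw [abs_le] at *
      constructor <;> linarith
    rcases Nat.eq_zero_or_pos k with rfl | hk0
    · simpa using Or.inl (hA x)
    · obtain ⟨k, rfl⟩ : ∃ m, k = m + 1 := ⟨k - 1, by omega⟩
      refine le_max_of_le_right ?_
      rw [iteratedDeriv_succ']
      refine hC₂ (deriv g) ?_ hderiv (fun y => ?_) k (by omega) x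
      · exact (contDiff_succ_iff_deriv.1 (by exact_mod_cast hg)).2.2
      · rw [← iteratedDeriv_succ']
        exact hB y

/-! ### The classes `C^{α-}` -/

theorem abs_sub_le_rpow_of_lipschitz_of_bounded {g : ℝ → ℝ} {B C s : ℝ} (hs0 : 0 < s)
    (hs1 : s < 1) (hB : ∀ x, |g x| ≤ B) (hC0 : 0 ≤ C) (hC : ∀ x y, |g x - g y| ≤ C * |x - y|)
    (x y : ℝ) : |g x - g y| ≤ (2 * B + C) * |x - y| ^ s := by
  have hB0 : 0 ≤ B := (abs_nonneg _).trans (hB 0)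
  rcases le_total |x - y| 1 with h | h
  · have h1 : |x - y| ≤ |x - y| ^ s := by
      simpa using Real.rpow_le_rpow_of_exponent_ge' (abs_nonneg (x - y)) h hs0.le hs1.le
    have h2 : 0 ≤ |x - y| ^ s := by positivity
    nlinarith [hC x y]
  · have h1 : 1 ≤ |x - y| ^ s := Real.one_le_rpow h hs0.le
    have h2 := abs_sub (g x) (g y)
    nlinarith [hB x, hB y]

theorem exists_nat_add_real {β : ℝ} (hβ : 0 < β) :
    ∃ (p : ℕ) (r : ℝ), β = p + r ∧ 0 < r ∧ r ≤ 1 := by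
  have h1 : 0 < ⌈β⌉₊ := Nat.ceil_pos.2 hβ
  obtain ⟨p, hp⟩ : ∃ p, ⌈β⌉₊ = p + 1 := ⟨⌈β⌉₊ - 1, by omega⟩
  have h2 : β ≤ p + 1 := by
    have := Nat.le_ceil β
    rw [hp] at this
    exact_mod_cast this
  have h3 : (p : ℝ) < β := Nat.lt_ceil.1 (by omega)
  exact ⟨p, β - p, by ring, by linarith, by linarith⟩

theorem nat_le_of_add_le_add {p q : ℕ} {r t : ℝ} (h : (q : ℝ) + t ≤ p + r) (ht : 0 < t)
    (hr : r ≤ 1) : q ≤ p := by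
  have : (q : ℝ) < p + 1 := by linarith
  exact Nat.lt_succ_iff.1 (by exact_mod_cast this)

/-- The decomposition `β = p + r` is unique, so one pair can be fixed for a whole family of
functions. -/
theorem cMinus_iff {β : ℝ} {p : ℕ} {r : ℝ} (hβ : β = p + r) (hr0 : 0 < r) (hr1 : r ≤ 1)
    (g : ℝ → ℝ) : CMinus β g ↔ ContDiff ℝ p g ∧ HolderMinus r (iteratedDeriv p g) := by
  refine ⟨?_, fun h => ⟨p, r, hβ, hr0, hr1, h⟩⟩
  rintro ⟨q, t, h, ht0, ht1, h'⟩
  obtain rfl : q = p := le_antisymm (nat_le_of_add_le_add (h.symm.trans hβ).le ht0 hr1)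
    (nat_le_of_add_le_add (hβ.symm.trans h).le hr0 ht1)
  obtain rfl : r = t := by linarith
  exact h'

/-- If the integer part drops, the lower derivative is bounded and Lipschitz, hence Hölder of every
exponent below 1. Boundedness of `g` is a separate hypothesis because `CMinus` bounds only the top
derivative. -/
theorem CMinus.mono {α β : ℝ} {g : ℝ → ℝ} (h : CMinus α g) (hg : ∃ C, ∀ x, |g x| ≤ C)
    (hβ : 0 < β) (hβα : β ≤ α) : CMinus β g := by
  obtain ⟨p, r, rfl, hr0, hr1, hp, hc, hb, hh⟩ := h
  obtain ⟨q, t, rfl, ht0, ht1⟩ := exists_nat_add_real hβ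
  have hqp : q ≤ p := nat_le_of_add_le_add hβα ht0 hr1
  refine ⟨q, t, rfl, ht0, ht1, hp.of_le (by exact_mod_cast hqp), ?_⟩
  rcases hqp.eq_or_lt with rfl | hlt
  · exact ⟨hc, hb, fun s hs hst => hh s hs (by linarith)⟩
  obtain ⟨A, hA⟩ := hg
  obtain ⟨B, hB⟩ := hb
  obtain ⟨C, hC⟩ := exists_bound_iteratedDeriv p A B
  have hC := hC g hp hA hB
  have hC0 : 0 ≤ C := (abs_nonneg _).trans (hC q hqp 0)
  have hlt' : (q : WithTop ℕ∞) < p := by exact_mod_cast hlt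
  refine ⟨hp.continuous_iteratedDeriv q hlt'.le, ⟨C, hC q hqp⟩, fun s hs hst => ?_⟩
  refine ⟨2 * C + C + 1, by linarith, fun x y => ?_⟩
  refine (abs_sub_le_rpow_of_lipschitz_of_bounded hs (by linarith) (hC q hqp) hC0
    (fun x y => ?_) x y).trans ?_
  · exact Convex.norm_image_sub_le_of_norm_deriv_le (s := Set.univ)
      (fun z _ => hp.differentiable_iteratedDeriv q hlt' z)
      (fun z _ => by rw [← iteratedDeriv_succ]; exact hC (q + 1) hlt z) convex_univ
      (Set.mem_univ y) (Set.mem_univ x)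
  · exact mul_le_mul_of_nonneg_right (by linarith) (by positivity)

/-! ### Uniform bounds for families of functionals -/

/-- Difference quotients are continuous functionals, and on a Banach space a pointwise limit of a
sequence of these is again continuous. -/
theorem exists_clm_deriv {E : Type*} [NormedAddCommGroup E] [NormedSpace ℝ E] [CompleteSpace E]
    (Φ : ℝ → E →L[ℝ] ℝ) (h : ∀ e, Differentiable ℝ fun x => Φ x e) :
    ∃ Ψ : ℝ → E →L[ℝ] ℝ, ∀ e, (fun x => Ψ x e) = deriv fun x => Φ x e := by
  have key : ∀ x, Filter.Tendsto (fun (t : ℝ) (e : E) => (t⁻¹ • (Φ (x + t) - Φ x)) e)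
      (nhdsWithin 0 (Set.Ioi 0)) (nhds fun e => deriv (fun y => Φ y e) x) := by
    intro x
    rw [tendsto_pi_nhds]
    intro e
    simpa using (h e x).hasDerivAt.tendsto_slope_zero_right
  exact ⟨fun x => continuousLinearMapOfTendsto _ (key x), fun e => rfl⟩

theorem exists_clm_iteratedDeriv {E : Type*} [NormedAddCommGroup E] [NormedSpace ℝ E]
    [CompleteSpace E] (Φ : ℝ → E →L[ℝ] ℝ) {p : ℕ} (h : ∀ e, ContDiff ℝ p fun x => Φ x e)
    {k : ℕ} (hk : k ≤ p) :
    ∃ Ψ : ℝ → E →L[ℝ] ℝ, ∀ e, (fun x => Ψ x e) = iteratedDeriv k fun x => Φ x e := by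
  induction k with
  | zero => exact ⟨Φ, fun e => by simp⟩
  | succ k ih =>
    obtain ⟨Ψ, hΨ⟩ := ih (by omega)
    obtain ⟨Θ, hΘ⟩ := exists_clm_deriv Ψ fun e => by
      rw [hΨ e]
      exact (h e).differentiable_iteratedDeriv k (by exact_mod_cast hk)
    exact ⟨Θ, fun e => by rw [hΘ e, hΨ e, iteratedDeriv_succ]⟩

/-- The uniform boundedness principle for a family of functionals. -/
theorem exists_bound_of_pointwise_bound {E ι : Type*} [NormedAddCommGroup E] [NormedSpace ℝ E]
    [CompleteSpace E] (Φ : ι → E →L[ℝ] ℝ) (h : ∀ e, ∃ C, ∀ i, |Φ i e| ≤ C) :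
    ∃ K, 0 ≤ K ∧ ∀ e i, |Φ i e| ≤ K * ‖e‖ := by
  obtain ⟨K, hK⟩ := banach_steinhaus (g := Φ) h
  refine ⟨max K 0, le_max_right _ _, fun e i => ((Φ i).le_opNorm e).trans ?_⟩
  gcongr
  exact (hK i).trans (le_max_left _ _)

/-- Uniform boundedness is applied to the Hölder quotients, indexed by pairs of points. -/
theorem exists_bound_of_holder {E : Type*} [NormedAddCommGroup E] [NormedSpace ℝ E]
    [CompleteSpace E] (Φ : ℝ → E →L[ℝ] ℝ) {s : ℝ} (hs : 0 < s)
    (h : ∀ e, ∃ C, 0 < C ∧ ∀ x y, |Φ x e - Φ y e| ≤ C * |x - y| ^ s) :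
    ∃ K, 0 ≤ K ∧ ∀ e x y, |Φ x e - Φ y e| ≤ K * ‖e‖ * |x - y| ^ s := by
  obtain ⟨K, hK0, hK⟩ := exists_bound_of_pointwise_bound
    (fun z : ℝ × ℝ => (|z.1 - z.2| ^ s)⁻¹ • (Φ z.1 - Φ z.2)) (fun e => by
      obtain ⟨C, hC0, hC⟩ := h e
      refine ⟨C, fun ⟨x, y⟩ => ?_⟩
      have h0 : 0 ≤ |x - y| ^ s := by positivity
      simp only [smul_apply, sub_apply, smul_eq_mul,
        abs_mul, abs_inv, abs_of_nonneg h0]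
      exact inv_mul_le_of_le_mul₀ h0 hC0.le (by rw [mul_comm]; exact hC x y))
  refine ⟨K, hK0, fun e x y => ?_⟩
  rcases eq_or_ne x y with rfl | hxy
  · simp [Real.zero_rpow hs.ne']
  have h0 : 0 < |x - y| ^ s := Real.rpow_pos_of_pos (abs_pos.2 (sub_ne_zero.2 hxy)) s
  have := hK e (x, y)
  simp only [smul_apply, sub_apply, smul_eq_mul,
    abs_mul, abs_inv, abs_of_pos h0] at this
  rwa [inv_mul_le_iff₀ h0, mul_comm] at this

/-! ### Regularity of series of dilates -/

theorem two_rpow_mul_lt_one {β c s : ℝ} (hc0 : 0 < c) (hβ : β ≤ -Real.logb 2 c) (hs : s < β) :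
    (2 : ℝ) ^ s * c < 1 := by
  have h1 : Real.logb 2 c < -s := by linarith
  have h2 := (Real.logb_lt_iff_lt_rpow one_lt_two hc0).1 h1
  calc (2 : ℝ) ^ s * c < 2 ^ s * 2 ^ (-s) := by gcongr
    _ = 1 := by rw [← Real.rpow_add two_pos]; simp

/-- A superposition of dilated functions, whose sizes decay geometrically, is in `C^{β-}`. -/
theorem cMinus_tsum {E : Type*} [NormedAddCommGroup E] [NormedSpace ℝ E] [CompleteSpace E]
    (Φ : ℝ → E →L[ℝ] ℝ) {A c β : ℝ} (hβ0 : 0 < β)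
    (hb : ∀ e, ∃ C, ∀ x, |Φ x e| ≤ C) (h : ∀ e, CMinus β fun x => Φ x e)
    (hc0 : 0 < c) (hβ : β ≤ -Real.logb 2 c) (e : ℕ → E) (he : ∀ j, ‖e j‖ ≤ A * c ^ j) :
    CMinus β fun x => ∑' j, Φ (2 ^ j * x) (e j) := by
  obtain ⟨p, r, hpr, hr0, hr1⟩ := exists_nat_add_real hβ0
  simp only [cMinus_iff hpr hr0 hr1] at h ⊢
  have hder : ∀ k ≤ p, ∃ Ψ : ℝ → E →L[ℝ] ℝ, ∃ K : ℝ, 0 ≤ K ∧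
      (∀ e, (fun x => Ψ x e) = iteratedDeriv k fun x => Φ x e) ∧
      ∀ e x, |iteratedDeriv k (fun x => Φ x e) x| ≤ K * ‖e‖ := by
    intro k hk
    obtain ⟨Ψ, hΨ⟩ := exists_clm_iteratedDeriv Φ (fun e => (h e).1) hk
    have hΨ' : ∀ e x, Ψ x e = iteratedDeriv k (fun x => Φ x e) x := fun e x => congrFun (hΨ e) x
    obtain ⟨K, hK0, hK⟩ := exists_bound_of_pointwise_bound Ψ fun e => by
      obtain ⟨A, hA⟩ := hb e
      obtain ⟨B, hB⟩ := (h e).2.2.1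
      obtain ⟨C, hC⟩ := exists_bound_iteratedDeriv p A B
      exact ⟨C, fun x => by rw [hΨ']; exact hC _ (h e).1 hA hB k hk x⟩
    exact ⟨Ψ, K, hK0, hΨ, fun e x => by rw [← hΨ']; exact hK e x⟩
  choose! Ψ K hK0 hΨ hK using hder
  let u : ℕ → ℝ → ℝ := fun j x => Φ (2 ^ j * x) (e j)
  have hu : ∀ j, ContDiff ℝ p (u j) := fun j =>
    (h (e j)).1.comp (contDiff_const.mul contDiff_id)
  have hud : ∀ k ≤ p, ∀ j x, iteratedDeriv k (u j) x =
      (2 ^ k) ^ j * iteratedDeriv k (fun x => Φ x (e j)) (2 ^ j * x) := by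
    intro k hk j x
    have := iteratedDeriv_comp_const_mul
      ((h (e j)).1.of_le (show (k : WithTop ℕ∞) ≤ p by exact_mod_cast hk)) ((2 : ℝ) ^ j)
    rw [← pow_mul, mul_comm k j, pow_mul]
    exact congrFun this x
  have hsum : ∀ s < β, ∀ B : ℝ, Summable fun j : ℕ => B * ((2 : ℝ) ^ s * c) ^ j := fun s hs B =>
    (summable_geometric_of_lt_one (by positivity) (two_rpow_mul_lt_one hc0 hβ hs)).mul_left B
  -- Weierstrass majorants for the `k`-th derivatives: `2^{kj}` from the dilation, `A c^j` from the
  -- size of `e j`.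
  let v : ℕ → ℕ → ℝ := fun k j => K k * A * ((2 : ℝ) ^ (k : ℝ) * c) ^ j
  have hv : ∀ k ≤ p, Summable (v k) := fun k hk => hsum k (by
    have : (k : ℝ) ≤ p := by exact_mod_cast hk
    linarith) _
  have hbound : ∀ k ≤ p, ∀ j x, |iteratedDeriv k (u j) x| ≤ v k j := by
    intro k hk j x
    rw [hud k hk, abs_mul, abs_of_nonneg (by positivity)]
    calc ((2 : ℝ) ^ k) ^ j * |iteratedDeriv k (fun x => Φ x (e j)) (2 ^ j * x)|
        ≤ ((2 : ℝ) ^ k) ^ j * (K k * (A * c ^ j)) := by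
          gcongr
          refine (hK k hk (e j) _).trans ?_
          gcongr
          · exact hK0 k hk
          · exact he j
      _ = v k j := by
          simp only [v, Real.rpow_natCast, mul_pow]
          ring
  have hv' : ∀ k : ℕ, (k : ℕ∞) ≤ (p : ℕ∞) → Summable (v k) := fun k hk =>
    hv k (by exact_mod_cast hk)
  have hbound' : ∀ (k : ℕ) (j : ℕ) (x : ℝ), (k : ℕ∞) ≤ (p : ℕ∞) →
      ‖iteratedFDeriv ℝ k (u j) x‖ ≤ v k j := fun k j x hk => by
    rw [norm_iteratedFDeriv_eq_norm_iteratedDeriv]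
    exact hbound k (by exact_mod_cast hk) j x
  have hC : ContDiff ℝ p fun x => ∑' j, u j x :=
    contDiff_tsum (N := (p : ℕ∞)) hu hv' hbound'
  have hsummable : ∀ x, Summable fun j => iteratedDeriv p (u j) x := fun x =>
    Summable.of_norm_bounded (hv p le_rfl) fun j => hbound p le_rfl j x
  have hD : ∀ x, iteratedDeriv p (fun x => ∑' j, u j x) x = ∑' j, iteratedDeriv p (u j) x := by
    intro x
    have hs : Summable fun j => iteratedFDeriv ℝ p (u j) x :=
      Summable.of_norm_bounded (hv p le_rfl) fun j => hbound' p j x le_rfl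
    simp only [iteratedDeriv_eq_iteratedFDeriv]
    rw [iteratedFDeriv_tsum_apply (N := (p : ℕ∞)) hu hv' hbound' le_rfl x]
    exact ContinuousMultilinearMap.tsum_eval hs _
  refine ⟨hC, hC.continuous_iteratedDeriv' p, ⟨∑' j, v p j, fun x => ?_⟩, fun s hs hsr => ?_⟩
  · rw [hD, ← Real.norm_eq_abs]
    exact tsum_of_norm_bounded (hv p le_rfl).hasSum fun j => hbound p le_rfl j x
  obtain ⟨H, hH0, hH⟩ := exists_bound_of_holder (Ψ p) hs fun e => by
    obtain ⟨C, hC0, hC⟩ := (h e).2.2.2 s hs hsr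
    exact ⟨C, hC0, fun x y => by
      have := hC x y
      rwa [← hΨ p le_rfl e] at this⟩
  have hA0 : 0 ≤ A := by simpa using (norm_nonneg _).trans (he 0)
  have hws := hsum (p + s) (by linarith) (H * A)
  -- The `+ 1` makes the Hölder constant strictly positive.
  refine ⟨(∑' j : ℕ, H * A * ((2 : ℝ) ^ (p + s) * c) ^ j) + 1, ?_, fun x y => ?_⟩
  · have : 0 ≤ ∑' j : ℕ, H * A * ((2 : ℝ) ^ (p + s) * c) ^ j :=
      tsum_nonneg fun j => by positivity
    linarith
  rw [hD, hD, ← (hsummable x).tsum_sub (hsummable y), ← Real.norm_eq_abs]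
  refine (tsum_of_norm_bounded (hws.hasSum.mul_right (|x - y| ^ s)) fun j => ?_).trans ?_
  · rw [hud p le_rfl, hud p le_rfl, ← mul_sub, norm_mul, Real.norm_of_nonneg (by positivity),
      ← hΨ p le_rfl, Real.norm_eq_abs]
    have h1 := hH (e j) (2 ^ j * x) (2 ^ j * y)
    have h2 : |(2 : ℝ) ^ j * x - 2 ^ j * y| ^ s = ((2 : ℝ) ^ s) ^ j * |x - y| ^ s := by
      rw [← mul_sub, abs_mul, abs_of_nonneg (by positivity),
        Real.mul_rpow (by positivity) (by positivity), ← Real.rpow_natCast, ← Real.rpow_natCast,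
        ← Real.rpow_mul two_pos.le, ← Real.rpow_mul two_pos.le, mul_comm s]
    rw [h2] at h1
    calc ((2 : ℝ) ^ p) ^ j * |Ψ p (2 ^ j * x) (e j) - Ψ p (2 ^ j * y) (e j)|
        ≤ ((2 : ℝ) ^ p) ^ j * (H * (A * c ^ j) * (((2 : ℝ) ^ s) ^ j * |x - y| ^ s)) := by
          gcongr
          refine h1.trans ?_
          gcongr
          exact he j
      _ = H * A * ((2 : ℝ) ^ (p + s) * c) ^ j * |x - y| ^ s := by
          rw [Real.rpow_add two_pos, Real.rpow_natCast, mul_pow, mul_pow]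
          ring
  · exact mul_le_mul_of_nonneg_right (by linarith) (by positivity)

/-! ### Limit functions -/

/-- Arbitrarily fine dyadic levels are needed because the iterates control a limit function only
from some level on. -/
theorem exists_dyadic_near {g : ℝ → ℝ} (hg : Continuous g) (x : ℝ) {ε : ℝ} (hε : 0 < ε) (J : ℕ) :
    ∃ j ≥ J, ∃ n : ℤ, |g x - g ((n : ℝ) / 2 ^ j)| ≤ ε := by
  obtain ⟨η, hη, h⟩ := Metric.continuous_iff.1 hg x ε hε
  obtain ⟨i, hi⟩ := exists_pow_lt_of_lt_one hη (show (1 / 2 : ℝ) < 1 by norm_num)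
  refine ⟨max i J, le_max_right _ _, ⌊x * 2 ^ max i J⌋, ?_⟩
  have hpos : (0 : ℝ) < 2 ^ max i J := by positivity
  have hlt : (1 / 2 : ℝ) ^ max i J < η :=
    (pow_le_pow_of_le_one (by norm_num) (by norm_num) (le_max_left i J)).trans_lt hi
  rw [abs_sub_comm]
  refine (h _ ?_).le
  rw [Real.dist_eq, abs_sub_comm]
  have h1 := Int.floor_le (x * 2 ^ max i J)
  have h2 := Int.lt_floor_add_one (x * 2 ^ max i J)
  have h3 : x - (⌊x * 2 ^ max i J⌋ : ℝ) / 2 ^ max i J =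
      (x * 2 ^ max i J - ⌊x * 2 ^ max i J⌋) * (1 / 2) ^ max i J := by
    rw [one_div, inv_pow]
    field_simp
  rw [h3, abs_mul, abs_of_nonneg (by linarith), abs_of_nonneg (by positivity)]
  exact (mul_le_of_le_one_left (by positivity) (by linarith)).trans_lt hlt

theorem BddSeq.abs_apply_le (f : BddSeq) (n : ℤ) : |f n| ≤ ‖f‖ :=
  lp.norm_apply_le_norm ENNReal.top_ne_zero f n

namespace IsLimitFunction

theorem unique {T : BddSeq → BddSeq} {f : BddSeq} {g₁ g₂ : ℝ → ℝ} (h₁ : IsLimitFunction T f g₁)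
    (h₂ : IsLimitFunction T f g₂) : g₁ = g₂ := by
  ext x
  refine eq_of_abs_sub_nonpos (le_of_forall_pos_le_add fun ε hε => ?_)
  obtain ⟨J₁, hJ₁⟩ := h₁.2.2 (ε / 3) (by positivity)
  obtain ⟨J₂, hJ₂⟩ := h₂.2.2 (ε / 3) (by positivity)
  obtain ⟨j, hj, n, hn⟩ := exists_dyadic_near (h₁.1.sub h₂.1) x (ε := ε / 3) (by positivity)
    (max J₁ J₂)
  have h1 := hJ₁ j ((le_max_left _ _).trans hj) n
  have h2 := hJ₂ j ((le_max_right _ _).trans hj) n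
  simp only [Pi.sub_apply] at hn
  rw [abs_le] at *
  constructor <;> linarith

theorem abs_le {T : BddSeq → BddSeq} {f : BddSeq} {g : ℝ → ℝ} (h : IsLimitFunction T f g)
    {B : ℝ} (hB : ∀ j, ‖T^[j] f‖ ≤ B) (x : ℝ) : |g x| ≤ B := by
  refine le_of_forall_pos_le_add fun ε hε => ?_
  obtain ⟨J, hJ⟩ := h.2.2 (ε / 2) (by positivity)
  obtain ⟨j, hj, n, hn⟩ := exists_dyadic_near h.1 x (ε := ε / 2) (by positivity) J
  have h1 := hJ j hj n
  have h2 := (BddSeq.abs_apply_le (T^[j] f) n).trans (hB j)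
  rw [_root_.abs_le] at *
  constructor <;> linarith

theorem add {S : BddSeq →L[ℝ] BddSeq} {f₁ f₂ : BddSeq} {g₁ g₂ : ℝ → ℝ}
    (h₁ : IsLimitFunction S f₁ g₁) (h₂ : IsLimitFunction S f₂ g₂) :
    IsLimitFunction S (f₁ + f₂) (g₁ + g₂) := by
  obtain ⟨c₁, ⟨C₁, b₁⟩, l₁⟩ := h₁
  obtain ⟨c₂, ⟨C₂, b₂⟩, l₂⟩ := h₂
  refine ⟨c₁.add c₂, ⟨C₁ + C₂, fun x => (abs_add_le _ _).trans (add_le_add (b₁ x) (b₂ x))⟩,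
    fun ε hε => ?_⟩
  obtain ⟨J₁, hJ₁⟩ := l₁ (ε / 2) (by positivity)
  obtain ⟨J₂, hJ₂⟩ := l₂ (ε / 2) (by positivity)
  refine ⟨max J₁ J₂, fun j hj n => ?_⟩
  have h1 := hJ₁ j ((le_max_left _ _).trans hj) n
  have h2 := hJ₂ j ((le_max_right _ _).trans hj) n
  rw [← FunLike.coe_pow_eq_iterate] at *
  simp only [map_add, lp.coeFn_add, Pi.add_apply]
  rw [_root_.abs_le] at *
  constructor <;> linarith

theorem smul {S : BddSeq →L[ℝ] BddSeq} {f : BddSeq} {g : ℝ → ℝ} (a : ℝ)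
    (h : IsLimitFunction S f g) : IsLimitFunction S (a • f) (a • g) := by
  obtain ⟨c, ⟨C, b⟩, l⟩ := h
  refine ⟨c.const_smul a, ⟨|a| * C, fun x => ?_⟩, fun ε hε => ?_⟩
  · rw [Pi.smul_apply, smul_eq_mul, abs_mul]
    exact mul_le_mul_of_nonneg_left (b x) (abs_nonneg a)
  obtain ⟨J, hJ⟩ := l (ε / (|a| + 1)) (by positivity)
  refine ⟨J, fun j hj n => ?_⟩
  have h1 := hJ j hj n
  rw [← FunLike.coe_pow_eq_iterate] at *
  simp only [map_smul, lp.coeFn_smul, Pi.smul_apply, smul_eq_mul]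
  rw [← mul_sub, abs_mul]
  rw [le_div_iff₀ (by positivity)] at h1
  nlinarith [abs_nonneg a, abs_nonneg ((S ^ j) f n - g ((n : ℝ) / 2 ^ j))]

end IsLimitFunction

/-! ### Convergence of superposed linear iterates -/

/-- The iterates of a convergent linear scheme are uniformly bounded. -/
theorem UniformlyConvergent.exists_bound_iterate {S : BddSeq →L[ℝ] BddSeq}
    (hS : UniformlyConvergent S) : ∃ K, 0 ≤ K ∧ ∀ j f, ‖S^[j] f‖ ≤ K * ‖f‖ := by
  obtain ⟨K, hK⟩ := banach_steinhaus (g := fun j : ℕ => S ^ j) fun f => by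
    obtain ⟨g, -, ⟨C, hC⟩, hg⟩ := hS f
    obtain ⟨J, hJ⟩ := hg 1 one_pos
    -- From level `J` on, `C + 1` bounds the orbit; the finite sum covers the earlier levels.
    refine ⟨C + 1 + ∑ i ∈ Finset.range J, ‖(S ^ i) f‖, fun j => ?_⟩
    have hC0 : 0 ≤ C := (abs_nonneg _).trans (hC 0)
    have hs : 0 ≤ ∑ i ∈ Finset.range J, ‖(S ^ i) f‖ := Finset.sum_nonneg fun i _ => norm_nonneg _
    rcases lt_or_ge j J with hj | hj
    · have := Finset.single_le_sum (f := fun i => ‖(S ^ i) f‖) (fun i _ => norm_nonneg _)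
        (Finset.mem_range.2 hj)
      linarith
    · refine lp.norm_le_of_forall_le (by linarith) fun n => ?_
      have h1 := hJ j hj n
      have h2 := hC ((n : ℝ) / 2 ^ j)
      rw [← FunLike.coe_pow_eq_iterate] at h1
      rw [Real.norm_eq_abs]
      rw [abs_le] at *
      constructor <;> linarith
  refine ⟨max K 0, le_max_right _ _, fun j f => ?_⟩
  rw [← FunLike.coe_pow_eq_iterate]
  refine ((S ^ j).le_opNorm f).trans ?_
  gcongr
  exact (hK j).trans (le_max_left _ _)

/-- The evaluations of the limit functions of a linear scheme are bounded functionals. -/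
theorem UniformlyConvergent.exists_limitFunctional {S : BddSeq →L[ℝ] BddSeq}
    (hS : UniformlyConvergent S) {K : ℝ} (hK : ∀ j f, ‖S^[j] f‖ ≤ K * ‖f‖) :
    ∃ Φ : ℝ → BddSeq →L[ℝ] ℝ, (∀ f, IsLimitFunction S f fun x => Φ x f) ∧
      ∀ x f, |Φ x f| ≤ K * ‖f‖ := by
  choose L hL using hS
  have hLK : ∀ x f, |L f x| ≤ K * ‖f‖ := fun x f => (hL f).abs_le (fun j => hK j f) x
  refine ⟨fun x => LinearMap.mkContinuous
    { toFun := fun f => L f x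
      map_add' := fun f₁ f₂ => congrFun ((hL _).unique ((hL f₁).add (hL f₂))) x
      map_smul' := fun a f => congrFun ((hL _).unique ((hL f).smul a)) x } K (hLK x),
    hL, hLK⟩

/-- A scheme whose iterates are sums of iterates of a convergent linear scheme, applied to details
which decay geometrically, converges to the sum of the dilated limits of the details. -/
theorem isLimitFunction_tsum {S : BddSeq →L[ℝ] BddSeq} {T : BddSeq → BddSeq} {K A c : ℝ}
    (hK0 : 0 ≤ K) (hK : ∀ j f, ‖S^[j] f‖ ≤ K * ‖f‖) {Φ : ℝ → BddSeq →L[ℝ] ℝ}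
    (hΦ : ∀ f, IsLimitFunction S f fun x => Φ x f) (hΦK : ∀ x f, |Φ x f| ≤ K * ‖f‖)
    (hc0 : 0 < c) (hc1 : c < 1) {e : ℕ → BddSeq} (he : ∀ j, ‖e j‖ ≤ A * c ^ j) {f : BddSeq}
    (hT : ∀ J, T^[J] f = ∑ j ∈ Finset.range (J + 1), S^[J - j] (e j)) :
    IsLimitFunction T f fun x => ∑' j, Φ (2 ^ j * x) (e j) := by
  have hA0 : 0 ≤ A := by simpa using (norm_nonneg _).trans (he 0)
  have hw : Summable fun j : ℕ => K * (A * c ^ j) :=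
    ((summable_geometric_of_lt_one hc0.le hc1).mul_left A).mul_left K
  have hKe : ∀ j, K * ‖e j‖ ≤ K * (A * c ^ j) := fun j => mul_le_mul_of_nonneg_left (he j) hK0
  have hΦe : ∀ j x, ‖Φ x (e j)‖ ≤ K * (A * c ^ j) := fun j x => (hΦK x _).trans (hKe j)
  refine ⟨continuous_tsum (fun j => (hΦ (e j)).1.comp (continuous_const.mul continuous_id)) hw
    fun j x => hΦe j _, ⟨_, fun x => tsum_of_norm_bounded hw.hasSum fun j => hΦe j _⟩, ?_⟩
  -- `D i j` is the uniform error of `S^i (e j)`: it tends to 0 in `i` and is dominated by a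
  -- summable sequence in `j`.
  let D : ℕ → ℕ → ℝ := fun i j => ⨆ n : ℤ, |S^[i] (e j) n - Φ ((n : ℝ) / 2 ^ i) (e j)|
  have hDle : ∀ i j (n : ℤ), |S^[i] (e j) n - Φ ((n : ℝ) / 2 ^ i) (e j)| ≤
      2 * (K * (A * c ^ j)) := by
    intro i j n
    have h1 := (BddSeq.abs_apply_le _ n).trans ((hK i (e j)).trans (hKe j))
    have h2 := hΦe j ((n : ℝ) / 2 ^ i)
    have h3 := abs_sub (S^[i] (e j) n) (Φ ((n : ℝ) / 2 ^ i) (e j))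
    rw [Real.norm_eq_abs] at h2
    linarith
  have hD0 : ∀ i j, 0 ≤ D i j := fun i j => Real.iSup_nonneg fun n => abs_nonneg _
  have hDb : ∀ i j, D i j ≤ 2 * (K * (A * c ^ j)) := fun i j => ciSup_le (hDle i j)
  have hDn : ∀ i j (n : ℤ), |S^[i] (e j) n - Φ ((n : ℝ) / 2 ^ i) (e j)| ≤ D i j := fun i j n =>
    le_ciSup (f := fun n : ℤ => |S^[i] (e j) n - Φ ((n : ℝ) / 2 ^ i) (e j)|)
      ⟨_, by rintro _ ⟨n, rfl⟩; exact hDle i j n⟩ n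
  -- Terms with `j > J` do not yet occur in `T^J f`, so their error is the tail of the limit series.
  -- Dominated convergence sends the total error to 0.
  let a : ℕ → ℕ → ℝ := fun J j => if j ≤ J then D (J - j) j else 2 * (K * (A * c ^ j))
  have ha0 : ∀ J j, 0 ≤ a J j := by
    intro J j
    simp only [a]
    split_ifs
    · exact hD0 _ _
    · positivity
  have hab : ∀ J j, ‖a J j‖ ≤ 2 * (K * (A * c ^ j)) := by
    intro J j
    rw [Real.norm_of_nonneg (ha0 J j)]
    simp only [a]
    split_ifs
    · exact hDb _ _
    · exact le_rfl
  have hlim : Filter.Tendsto (fun J => ∑' j, a J j) Filter.atTop (nhds (∑' _ : ℕ, (0 : ℝ))) := by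
    refine tendsto_tsum_of_dominated_convergence (hw.mul_left 2) (fun j => ?_)
      (Filter.Eventually.of_forall fun J j => hab J j)
    rw [Metric.tendsto_atTop]
    intro ε hε
    obtain ⟨I, hI⟩ := (hΦ (e j)).2.2 (ε / 2) (by positivity)
    refine ⟨I + j, fun J hJ => ?_⟩
    rw [Real.dist_eq, sub_zero, abs_of_nonneg (ha0 J j)]
    simp only [a, if_pos (show j ≤ J by omega)]
    exact (ciSup_le (hI (J - j) (by omega))).trans_lt (by linarith)
  rw [tsum_zero, Metric.tendsto_atTop] at hlim
  intro ε hε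
  obtain ⟨J₀, hJ₀⟩ := hlim ε hε
  refine ⟨J₀, fun J hJ n => ?_⟩
  have h1 := hJ₀ J hJ
  rw [Real.dist_eq, sub_zero] at h1
  refine le_trans ?_ ((le_abs_self _).trans h1.le)
  let b : ℕ → ℝ := fun j => if j ≤ J then S^[J - j] (e j) n else 0
  have hbsupp : ∀ j ∉ Finset.range (J + 1), b j = 0 := fun j hj =>
    if_neg (by simpa using hj)
  have hb : T^[J] f n = ∑' j, b j := by
    rw [tsum_eq_sum hbsupp, hT, lp.coeFn_sum, Finset.sum_apply]
    exact Finset.sum_congr rfl fun j hj => (if_pos (by simpa [Nat.lt_succ_iff] using hj)).symm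
  have hΦs : Summable fun j => Φ (2 ^ j * ((n : ℝ) / 2 ^ J)) (e j) :=
    Summable.of_norm_bounded hw fun j => hΦe j _
  rw [hb, ← (summable_of_ne_finset_zero hbsupp).tsum_sub hΦs]
  rw [← Real.norm_eq_abs]
  refine tsum_of_norm_bounded
    (Summable.of_norm_bounded (hw.mul_left 2) (hab J)).hasSum fun j => ?_
  simp only [a, b]
  split_ifs with hj
  · have hx : (2 : ℝ) ^ j * ((n : ℝ) / 2 ^ J) = n / 2 ^ (J - j) := by
      obtain ⟨i, rfl⟩ := Nat.exists_eq_add_of_le hj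
      rw [Nat.add_sub_cancel_left, pow_add]
      field_simp
    rw [hx]
    exact hDn (J - j) j n
  · rw [zero_sub, norm_neg]
    have := hΦe j (2 ^ j * ((n : ℝ) / 2 ^ J))
    have h0 := norm_nonneg (Φ (2 ^ j * ((n : ℝ) / 2 ^ J)) (e j))
    linarith

/-! ### The nonlinear scheme -/

theorem nonlinearScheme_eq_add {S δ : BddSeq →L[ℝ] BddSeq} {F : BddSeq → BddSeq}
    (hS : Interpolatory S) (hF : ∀ (f : BddSeq) (n : ℤ), F (δ f) (2 * n) = 0) (f : BddSeq) :
    nonlinearScheme S δ F f = S f + F (δ f) := by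
  ext k
  obtain ⟨n, rfl | rfl⟩ := Int.even_or_odd' k
  · rw [nonlinearScheme_even, lp.coeFn_add, Pi.add_apply, hS, hF, add_zero]
  · rw [nonlinearScheme_odd, lp.coeFn_add, Pi.add_apply]

/-- The details of the nonlinear scheme: the data, and then the nonlinear corrections. -/
noncomputable def schemeDetail (S δ : BddSeq →L[ℝ] BddSeq) (F : BddSeq → BddSeq) (f : BddSeq) :
    ℕ → BddSeq
  | 0 => f
  | j + 1 => F (δ ((nonlinearScheme S δ F)^[j] f))

theorem iterate_nonlinearScheme {S δ : BddSeq →L[ℝ] BddSeq} {F : BddSeq → BddSeq}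
    (hS : Interpolatory S) (hF : ∀ (f : BddSeq) (n : ℤ), F (δ f) (2 * n) = 0) (f : BddSeq)
    (J : ℕ) : (nonlinearScheme S δ F)^[J] f =
      ∑ j ∈ Finset.range (J + 1), S^[J - j] (schemeDetail S δ F f j) := by
  induction J with
  | zero => simp [schemeDetail]
  | succ J ih =>
    rw [Function.iterate_succ_apply', nonlinearScheme_eq_add hS hF, Finset.sum_range_succ,
      Nat.sub_self, Function.iterate_zero_apply, schemeDetail]
    congr 1
    rw [ih, map_sum]
    refine Finset.sum_congr rfl fun j hj => ?_
    rw [← Function.iterate_succ_apply' S, Nat.succ_sub (by simpa [Nat.lt_succ_iff] using hj)]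

theorem norm_differences_iterate_le {S δ : BddSeq →L[ℝ] BddSeq} {F : BddSeq → BddSeq}
    (hS : Interpolatory S) (hF : ∀ (f : BddSeq) (n : ℤ), F (δ f) (2 * n) = 0) {c : ℝ}
    (hc0 : 0 ≤ c) (h : ∀ f : BddSeq, ‖δ (S f) + δ (F (δ f))‖ ≤ c * ‖δ f‖) (f : BddSeq) (j : ℕ) :
    ‖δ ((nonlinearScheme S δ F)^[j] f)‖ ≤ c ^ j * ‖δ f‖ := by
  induction j with
  | zero => simp
  | succ j ih =>
    rw [Function.iterate_succ_apply', nonlinearScheme_eq_add hS hF, map_add]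
    refine (h _).trans ?_
    rw [pow_succ', mul_assoc]
    gcongr

theorem exists_bound_schemeDetail {S δ : BddSeq →L[ℝ] BddSeq} {F : BddSeq → BddSeq}
    (hS : Interpolatory S) (hF : ∀ (f : BddSeq) (n : ℤ), F (δ f) (2 * n) = 0) {M c : ℝ}
    (hM : 0 < M) (hc0 : 0 < c) (h1 : ∀ d : BddSeq, ‖F d‖ ≤ M * ‖d‖)
    (h2 : ∀ f : BddSeq, ‖δ (S f) + δ (F (δ f))‖ ≤ c * ‖δ f‖) (f : BddSeq) :
    ∃ A, ∀ j, ‖schemeDetail S δ F f j‖ ≤ A * c ^ j := by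
  -- Detail `j + 1` is only of order `c ^ j`; dividing by `c` absorbs the shift.
  refine ⟨max ‖f‖ (M * ‖δ f‖ / c), fun j => ?_⟩
  cases j with
  | zero => simp [schemeDetail]
  | succ j =>
    calc ‖schemeDetail S δ F f (j + 1)‖ ≤ M * (c ^ j * ‖δ f‖) := by
          refine (h1 _).trans ?_
          gcongr
          exact norm_differences_iterate_le hS hF hc0.le h2 f j
      _ = M * ‖δ f‖ / c * c ^ (j + 1) := by
          field_simp
          ring
      _ ≤ _ := by
          gcongr
          exact le_max_right _ _

/-- Convergence and regularity of the nonlinear scheme for a positive contraction factor. -/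
theorem nonlinearScheme_convergent_and_regular {S δ : BddSeq →L[ℝ] BddSeq} {F : BddSeq → BddSeq}
    (hS : Interpolatory S) (hconv : UniformlyConvergent S)
    (hF : ∀ (f : BddSeq) (n : ℤ), F (δ f) (2 * n) = 0) {M c : ℝ} (hM : 0 < M) (hc0 : 0 < c)
    (hc1 : c < 1) (h1 : ∀ d : BddSeq, ‖F d‖ ≤ M * ‖d‖)
    (h2 : ∀ f : BddSeq, ‖δ (S f) + δ (F (δ f))‖ ≤ c * ‖δ f‖) :
    UniformlyConvergent (nonlinearScheme S δ F) ∧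
      ∀ β : ℝ, 0 < β → β ≤ -Real.logb 2 c →
        (∀ (f : BddSeq) (g : ℝ → ℝ), IsLimitFunction S f g → CMinus β g) →
        ∀ (f : BddSeq) (g : ℝ → ℝ), IsLimitFunction (nonlinearScheme S δ F) f g →
          CMinus β g := by
  obtain ⟨K, hK0, hK⟩ := hconv.exists_bound_iterate
  obtain ⟨Φ, hΦ, hΦK⟩ := hconv.exists_limitFunctional hK
  have hlim : ∀ f, IsLimitFunction (nonlinearScheme S δ F) f
      fun x => ∑' j, Φ (2 ^ j * x) (schemeDetail S δ F f j) := fun f => by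
    obtain ⟨A, hA⟩ := exists_bound_schemeDetail hS hF hM hc0 h1 h2 f
    exact isLimitFunction_tsum hK0 hK hΦ hΦK hc0 hc1 hA (iterate_nonlinearScheme hS hF f)
  refine ⟨fun f => ⟨_, hlim f⟩, fun β hβ0 hβ hreg f g hg => ?_⟩
  obtain ⟨A, hA⟩ := exists_bound_schemeDetail hS hF hM hc0 h1 h2 f
  rw [hg.unique (hlim f)]
  exact cMinus_tsum Φ hβ0 (fun e => (hΦ e).2.1) (fun e => hreg e _ (hΦ e)) hc0 hβ _ hA

theorem theorem1 (S δ : BddSeq →L[ℝ] BddSeq) (F : BddSeq → BddSeq)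
    (hS : Interpolatory S) (hconv : UniformlyConvergent S)
    (hF : ∀ (f : BddSeq) (n : ℤ), F (δ f) (2 * n) = 0)
    (M c : ℝ) (hM : 0 < M) (hc : c < 1)
    (h1 : ∀ d : BddSeq, ‖F d‖ ≤ M * ‖d‖)
    (h2 : ∀ f : BddSeq, ‖δ (S f) + δ (F (δ f))‖ ≤ c * ‖δ f‖) :
    UniformlyConvergent (nonlinearScheme S δ F) ∧
      ∀ α : ℝ, 0 < α →
        (∀ (f : BddSeq) (g : ℝ → ℝ), IsLimitFunction S f g → CMinus α g) →
        ∀ (f : BddSeq) (g : ℝ → ℝ), IsLimitFunction (nonlinearScheme S δ F) f g →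
          CMinus (limitExponent α c) g := by
  -- Any `b ≥ c` is also a contraction factor, which allows `b > 0` even when `c ≤ 0`.
  have main := fun (b : ℝ) (hb0 : 0 < b) (hb1 : b < 1) (hcb : c ≤ b) =>
    nonlinearScheme_convergent_and_regular hS hconv hF hM hb0 hb1 h1 fun f =>
      (h2 f).trans (mul_le_mul_of_nonneg_right hcb (norm_nonneg _))
  refine ⟨(main (max c (1 / 2)) (by positivity) (max_lt hc (by norm_num))
    (le_max_left _ _)).1, fun α hα hreg => ?_⟩
  rw [limitExponent]
  split_ifs with hc0
  · have hlog : 0 < -Real.logb 2 c := neg_pos.2 (Real.logb_neg one_lt_two hc0 hc)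
    exact (main c hc0 hc le_rfl).2 _ (lt_min hα hlog) (min_le_right _ _) fun f g hg =>
      (hreg f g hg).mono hg.2.1 (lt_min hα hlog) (min_le_left _ _)
  -- For `c ≤ 0`, the factor `b = 2^{-α}` gives `-log₂ b = α`, so no regularity is lost.
  · have hb0 : (0 : ℝ) < 2 ^ (-α) := by positivity
    refine (main (2 ^ (-α)) hb0 ?_ (by linarith)).2 α hα ?_ hreg
    · exact Real.rpow_lt_one_of_one_lt_of_neg one_lt_two (by linarith)
    · rw [Real.logb_rpow two_pos (by norm_num), neg_neg]
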